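/- **Setup.** Let $n,p\ge 1$, $d\ge 0$, let $\sigma:\mathbb R\to\mathbb R$ be differentiable, $\mathbf a\in\mathbb R^p$, and for $\mathbf W\in\mathbb R^{p\times d}$ let $f(\mathbf x;\mathbf a,\mathbf W)=\mathbf a^\top\sigma(\mathbf W\mathbf x)$, with $\sigma$ applied entrywise. Let $(\mathbf x_i,y_i)\in\mathbb R^d\times\mathbb R$, $i=1,\dots,n$, be arbitrary data with $\|\mathbf x_i\|_2\le B_x$ and $|y_i|\le B_y$, and for $\lambda>0$ put $$\tilde L(\mathbf W)=\frac1n\sum_{i=1}^n\frac12\bigl(y_i-f(\mathbf x_i;\mathbf a,\mathbf W)\bigr)^2+\frac\lambda2\|\mathbf W\|_F^2 .$$ Assume that $|\sigma'(t)|\le M_D$ for all $t\in\mathbb R$ and that $\sigma$ is $L$-Lipschitz. Gradients, Laplacians and norms on $\mathbb R^{p\times d}$ are those of the Euclidean (Frobenius) structure. **Definition.** A function $g:\mathbb R^m\to\mathbb R$ is a *Villani function* if (1) $g\in C^\infty$; (2) $g(\mathbf x)\to+\infty$ as $\|\mathbf x\|\to\infty$; (3) $\int\exp(-2g(\mathbf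 x)/s)\,d\mathbf x<\infty$ for all $s>0$; (4) $-\Delta g(\mathbf x)+\frac1s\|\nabla g(\mathbf x)\|^2\to+\infty$ as $\|\mathbf x\|\to\infty$, for all $s>0$. **Lemma.** Let $\lambda_c:=2M_DLB_x^2\|\mathbf a\|_2^2$. 1. Suppose $\lambda>\lambda_c$. (a) If $\sigma\in C^\infty$ and $\sigma''$ is bounded, then $\tilde L$ is a Villani function. (b) For every $s>0$, $\exp(-2\tilde L/s)$ is integrable, and the Gibbs probability measure $\mu_s=\frac1{Z_s}\exp(-2\tilde L/s)$ satisfies a Poincaré-type inequality: there is $\lambda_s>0$ such that for all $h\in C_c^\infty(\mathbb R^{p\times d})$, $$\mathrm{Var}_{\mu_s}[h]\le\frac{s}{2\lambda_s}\,\mathbb E_{\mu_s}\bigl[\|\nabla h\|^2\bigr].$$ 2. For every $\lambda>0$: if $\sigma\in C^\infty$, $|\sigma|\le B_\sigma$, $\sigma'$ is $L'_\sigma$-Lipschitz and $|\sigma''|\le M_D'$, then there is $\mathrm{gLip}(\tilde L)>0$ such that $\nabla\tilde L$ is $\mathrm{gLip}(\tilde L)$-Lipschitz, and $$\mathrm{gLip}(\tilde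 L)\le\sqrt p\left(\|\mathbf a\|_2B_x^2B_yL'_\sigma+\sqrt p\,\|\mathbf a\|_2^2M_D^2B_x^2+p\,\|\mathbf a\|_2^2B_x^2M_D'B_\sigma+\lambda\right).$$ -/

import Mathlib

open scoped ContDiff

noncomputable section

/-- The weight space `ℝ^{p × d}`; its Euclidean norm is the Frobenius norm of the matrix. -/
abbrev WeightSpace (p d : ℕ) : Type := EuclideanSpace ℝ (Fin p × Fin d)

/-- The depth-2 net `x ↦ aᵀ σ(W x)`, with `σ` acting entrywise. -/
def depthTwoNet {p d : ℕ} (σ : ℝ → ℝ) (a : EuclideanSpace ℝ (Fin p))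
    (W : WeightSpace p d) (x : EuclideanSpace ℝ (Fin d)) : ℝ :=
  ∑ j : Fin p, a j * σ (∑ k : Fin d, W (j, k) * x k)

/-- The loss on one data point: `(1/2) (y - aᵀ σ(W x))²`. -/
def dataLoss {p d : ℕ} (σ : ℝ → ℝ) (a : EuclideanSpace ℝ (Fin p))
    (x : EuclideanSpace ℝ (Fin d)) (y : ℝ) (W : WeightSpace p d) : ℝ :=
  (1 / 2) * (y - depthTwoNet σ a W x) ^ 2

/-- The regularized empirical risk
`(1/n) ∑ᵢ (1/2) (yᵢ - aᵀ σ(W xᵢ))² + (lam/2) ‖W‖_F²`. -/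
def regLoss {n p d : ℕ} (σ : ℝ → ℝ) (a : EuclideanSpace ℝ (Fin p))
    (x : Fin n → EuclideanSpace ℝ (Fin d)) (y : Fin n → ℝ) (lam : ℝ)
    (W : WeightSpace p d) : ℝ :=
  (1 / (n : ℝ)) * ∑ i : Fin n, dataLoss σ a (x i) (y i) W + lam / 2 * ‖W‖ ^ 2

/-- The critical regularization `2 M_D L B_x² ‖a‖₂²`. -/
def criticalReg {p : ℕ} (MD L Bx : ℝ) (a : EuclideanSpace ℝ (Fin p)) : ℝ :=
  2 * MD * L * Bx ^ 2 * ‖a‖ ^ 2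

section Landscape

variable {E : Type*} [NormedAddCommGroup E] [InnerProductSpace ℝ E] [FiniteDimensional ℝ E]
  [MeasurableSpace E] [BorelSpace E]

/-- Villani functions on a finite-dimensional Euclidean space. The filter
`Bornology.cobounded E` expresses `‖x‖ → ∞`. -/
structure IsVillani (f : E → ℝ) : Prop where
  smooth : ContDiff ℝ ∞ f
  tendsto_top : Filter.Tendsto f (Bornology.cobounded E) Filter.atTop
  integrable_exp : ∀ s : ℝ, 0 < s →
    MeasureTheory.Integrable (fun x => Real.exp (-(2 * f x) / s)) MeasureTheory.volume
  tendsto_laplacian : ∀ s : ℝ, 0 < s →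
    Filter.Tendsto (fun x => -Laplacian.laplacian f x + (1 / s) * ‖gradient f x‖ ^ 2)
      (Bornology.cobounded E) Filter.atTop

/-- The Gibbs measure `Z_s⁻¹ exp(-2 f / s) dx` with `Z_s = ∫ exp(-2 f / s) dx`. -/
def gibbsMeasure (f : E → ℝ) (s : ℝ) : MeasureTheory.Measure E :=
  MeasureTheory.volume.tilted (fun x => -(2 * f x) / s)

/-- The density `exp(-2 f / s)` is integrable (so that the Gibbs measure is a well-defined
probability measure) and the Gibbs measure satisfies the Poincaré-type inequality with
constant `lams > 0`:
`Var[h] ≤ s / (2 lams) * 𝔼 ‖∇h‖²` for all smooth compactly supported `h`. -/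
structure GibbsPoincare (f : E → ℝ) (s lams : ℝ) : Prop where
  integrable_exp :
    MeasureTheory.Integrable (fun x => Real.exp (-(2 * f x) / s)) MeasureTheory.volume
  const_pos : 0 < lams
  variance_le : ∀ h : E → ℝ, ContDiff ℝ ∞ h → HasCompactSupport h →
    ProbabilityTheory.variance h (gibbsMeasure f s) ≤
      s / (2 * lams) * ∫ x, ‖gradient h x‖ ^ 2 ∂(gibbsMeasure f s)

end Landscape

/-- `f` is differentiable with `K`-Lipschitz gradient (`f` is `K`-smooth). -/
def IsGradLipschitz {E : Type*} [NormedAddCommGroup E] [InnerProductSpace ℝ E] [CompleteSpace E]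
    (f : E → ℝ) (K : ℝ) : Prop :=
  Differentiable ℝ f ∧ ∀ x y : E, ‖gradient f x - gradient f y‖ ≤ K * ‖x - y‖

end

/-! Everything rests on dissipativity. The data term of the gradient has norm at most `F' + κ‖W‖`,
because the residual grows at most linearly (rate `‖a‖ L Bx`) and the net's gradient is bounded by
`‖a‖ MD Bx`. The threshold is `2κ`, so above it `⟨∇f(W), W⟩ ≥ (lam/4)‖W‖² - D`
(`exists_dissipative_regLoss`), while the regularizer alone makes `f` quadratically large.

Villani condition: dissipativity forces `‖∇f‖` to grow at least linearly, so `‖∇f‖²/s` is at least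
quadratic, whereas the Laplacian grows at most linearly when `σ''` is bounded
(`isVillani_of_dissipative`).

Poincaré inequality: `f` need only be differentiable, so no Hessian may be used. Instead the
divergence theorem is applied to the radial field `u² exp(-2f/s) x`. Dissipativity then bounds the
weighted `L²` norm of `u` by its energy plus its mass on a large ball (`integral_sq_mul_exp_le`).
Taking `u = h - k`, that mass is handled by the Poincaré inequality on the ball, where the Gibbs
density lies between positive constants (`exists_weighted_poincare`).

Gradient-Lipschitz bound: for bounded `σ` the residual is bounded, and the product rule gives an
explicit constant smaller than the stated one. -/

/-! ### Poincaré inequality on bounded convex sets and balls. -/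

section LocalPoincare

open MeasureTheory Module Set
open scoped ENNReal

variable {E : Type*} [NormedAddCommGroup E] [NormedSpace ℝ E]

/-- Cauchy–Schwarz along a segment: `(h y - h x)²` is controlled by the integral of `‖dh‖²`. -/
lemma ofReal_sq_sub_le_lintegral_segment {h : E → ℝ} (hh : ContDiff ℝ 1 h) (x y : E) :
    ENNReal.ofReal ((h x - h y) ^ 2) ≤ ENNReal.ofReal (‖x - y‖ ^ 2) *
      ∫⁻ t in Ioc (0 : ℝ) 1, ENNReal.ofReal (‖fderiv ℝ h ((1 - t) • x + t • y)‖ ^ 2) := by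
  have hc : Continuous (fderiv ℝ h) := hh.continuous_fderiv one_ne_zero
  set q : ℝ → E := fun t => (1 - t) • x + t • y with hq
  have hqc : Continuous q := by fun_prop
  set φ : ℝ → ℝ := fun t => fderiv ℝ h (q t) (y - x) with hφ
  have hφc : Continuous φ := (hc.comp hqc).clm_apply continuous_const
  have hqd : ∀ t, HasDerivAt q (y - x) t := fun t => by
    have h1 : HasDerivAt (fun t : ℝ => (1 - t) • x) ((-1 : ℝ) • x) t :=
      ((hasDerivAt_id t).const_sub 1).smul_const x
    have h2 : HasDerivAt (fun t : ℝ => t • y) ((1 : ℝ) • y) t :=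
      (hasDerivAt_id t).smul_const y
    convert! h1.add h2 using 1
    module
  have hder : ∀ t, HasDerivAt (fun t => h (q t)) (φ t) t := fun t =>
    ((hh.differentiable one_ne_zero (q t)).hasFDerivAt).comp_hasDerivAt t (hqd t)
  have hFTC : ∫ t in (0 : ℝ)..1, φ t = h y - h x := by
    rw [intervalIntegral.integral_eq_sub_of_hasDerivAt (fun t _ => hder t)
      (hφc.intervalIntegrable _ _)]
    simp [hq]
  set m := h y - h x with hm
  -- Jensen's inequality, from integrating `(φ - m)² ≥ 0` with `m = ∫ φ`.
  have hJ : m ^ 2 ≤ ∫ t in (0 : ℝ)..1, φ t ^ 2 := by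
    have : ∫ t in (0 : ℝ)..1, (2 * m * φ t - m ^ 2) ≤ ∫ t in (0 : ℝ)..1, φ t ^ 2 := by
      refine intervalIntegral.integral_mono_on zero_le_one
        ((by fun_prop : Continuous _).intervalIntegrable _ _)
        ((by fun_prop : Continuous _).intervalIntegrable _ _) fun t _ => ?_
      nlinarith [sq_nonneg (φ t - m)]
    rw [intervalIntegral.integral_sub ((by fun_prop : Continuous _).intervalIntegrable _ _)
      (by simp), intervalIntegral.integral_const_mul, hFTC] at this
    simp at this
    nlinarith
  have hle : ∫ t in (0 : ℝ)..1, φ t ^ 2 ≤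
      ∫ t in (0 : ℝ)..1, ‖x - y‖ ^ 2 * ‖fderiv ℝ h (q t)‖ ^ 2 := by
    refine intervalIntegral.integral_mono_on zero_le_one
      ((by fun_prop : Continuous _).intervalIntegrable _ _)
      ((by fun_prop : Continuous _).intervalIntegrable _ _) fun t _ => ?_
    have := (fderiv ℝ h (q t)).le_opNorm (y - x)
    rw [← mul_pow, ← sq_abs, norm_sub_rev x y]
    rw [Real.norm_eq_abs] at this
    gcongr
    linarith
  rw [intervalIntegral.integral_const_mul, intervalIntegral.integral_of_le
    (f := fun t => ‖fderiv ℝ h (q t)‖ ^ 2) zero_le_one] at hle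
  calc ENNReal.ofReal ((h x - h y) ^ 2) = ENNReal.ofReal (m ^ 2) := by congr 1; rw [hm]; ring
    _ ≤ ENNReal.ofReal (‖x - y‖ ^ 2 * ∫ t in Ioc (0 : ℝ) 1, ‖fderiv ℝ h (q t)‖ ^ 2) :=
        ENNReal.ofReal_le_ofReal (hJ.trans hle)
    _ = _ := by
        rw [ENNReal.ofReal_mul (by positivity), ofReal_integral_eq_lintegral_ofReal]
        · exact ((by fun_prop : Continuous fun t => ‖fderiv ℝ h (q t)‖ ^ 2).integrableOn_Icc
            (a := 0) (b := 1)).mono_set Ioc_subset_Icc_self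
        · exact Filter.Eventually.of_forall fun t => by positivity

variable [FiniteDimensional ℝ E] [MeasurableSpace E] [BorelSpace E]
  (μ : Measure E) [μ.IsAddHaarMeasure]

lemma lintegral_comp_add_smul (F : E → ℝ≥0∞) (hF : Measurable F) (z : E) {t : ℝ} (ht : 0 < t) :
    ∫⁻ y, F (z + t • y) ∂μ = ENNReal.ofReal ((t ^ finrank ℝ E)⁻¹) * ∫⁻ y, F y ∂μ := by
  have h1 : ∫⁻ y, F (z + t • y) ∂μ = ∫⁻ y, F (z + y) ∂(μ.map (t • ·)) := by
    rw [lintegral_map (by fun_prop) (by fun_prop)]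
  rw [h1, Measure.map_addHaar_smul μ ht.ne', lintegral_smul_measure,
    lintegral_add_left_eq_self F z, abs_of_pos (by positivity), smul_eq_mul]

/-- Contracting a convex set towards one of its points by a factor `t ≥ 1/2` increases integrals
of nonnegative functions at most by the factor `2 ^ dim`. -/
lemma setLIntegral_comp_homothety_le {K : Set E} (hK : Convex ℝ K) (hKm : MeasurableSet K)
    {g : E → ℝ≥0∞} (hg : Measurable g) {x : E} (hx : x ∈ K) {t : ℝ} (ht : 1 / 2 ≤ t)
    (ht1 : t ≤ 1) :
    ∫⁻ y in K, g ((1 - t) • x + t • y) ∂μ ≤ 2 ^ finrank ℝ E * ∫⁻ y in K, g y ∂μ := by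
  have ht0 : 0 < t := by linarith
  -- Convexity keeps the contracted points in `K`, so `g` can be cut off to `K` before passing to
  -- the whole space; the rescaling then costs the Jacobian `t^(-dim) ≤ 2^dim`.
  calc ∫⁻ y in K, g ((1 - t) • x + t • y) ∂μ
      ≤ ∫⁻ y in K, K.indicator g ((1 - t) • x + t • y) ∂μ := by
        refine setLIntegral_mono' hKm fun y hy => ?_
        rw [indicator_of_mem (hK hx hy (by linarith) ht0.le (by ring))]
    _ ≤ ∫⁻ y, K.indicator g ((1 - t) • x + t • y) ∂μ := setLIntegral_le_lintegral _ _
    _ = ENNReal.ofReal ((t ^ finrank ℝ E)⁻¹) * ∫⁻ y, K.indicator g y ∂μ :=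
        lintegral_comp_add_smul μ _ (hg.indicator hKm) _ ht0
    _ ≤ _ := by
        rw [lintegral_indicator hKm]
        gcongr
        have : (2 : ℝ≥0∞) ^ finrank ℝ E = ENNReal.ofReal (2 ^ finrank ℝ E) := by
          rw [ENNReal.ofReal_pow zero_le_two]; norm_num
        rw [this]
        refine ENNReal.ofReal_le_ofReal ?_
        rw [← inv_pow]
        gcongr
        rw [inv_le_comm₀ ht0 two_pos]
        linarith

/-- **Poincaré inequality on bounded convex sets**, with the variance written as a double
integral. -/
lemma lintegral_lintegral_sq_sub_le {K : Set E} (hK : Convex ℝ K) (hKm : MeasurableSet K)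
    {D : ℝ} (hD : ∀ x ∈ K, ∀ y ∈ K, ‖x - y‖ ≤ D) {h : E → ℝ} (hh : ContDiff ℝ 1 h) :
    ∫⁻ x in K, ∫⁻ y in K, ENNReal.ofReal ((h x - h y) ^ 2) ∂μ ∂μ ≤
      ENNReal.ofReal (D ^ 2) * 2 ^ finrank ℝ E *
        (∫⁻ z in K, ENNReal.ofReal (‖fderiv ℝ h z‖ ^ 2) ∂μ) * μ K := by
  have hc : Continuous (fderiv ℝ h) := hh.continuous_fderiv one_ne_zero
  set g : E → ℝ≥0∞ := fun z => ENNReal.ofReal (‖fderiv ℝ h z‖ ^ 2) with hg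
  have hgm : Measurable g := by
    exact ENNReal.measurable_ofReal.comp
      (by fun_prop : Continuous fun z => ‖fderiv ℝ h z‖ ^ 2).measurable
  set I := ∫⁻ z in K, g z ∂μ with hI
  have key : ∀ t ∈ Ioc (0 : ℝ) 1, ∫⁻ x in K, ∫⁻ y in K, g ((1 - t) • x + t • y) ∂μ ∂μ ≤
      2 ^ finrank ℝ E * I * μ K := by
    intro t ht
    -- One of `t` and `1 - t` is at least `1/2`. Integrating first in the variable carrying that
    -- weight keeps the Jacobian bounded by `2^dim`.
    rcases le_total (1 / 2) t with h1 | h1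
    · calc _ ≤ ∫⁻ x in K, 2 ^ finrank ℝ E * I ∂μ :=
            setLIntegral_mono' hKm fun x hx =>
              setLIntegral_comp_homothety_le μ hK hKm hgm hx h1 ht.2
        _ = _ := by simp
    · rw [lintegral_lintegral_swap]
      · calc _ ≤ ∫⁻ y in K, 2 ^ finrank ℝ E * I ∂μ := by
              refine setLIntegral_mono' hKm fun y hy => ?_
              have := setLIntegral_comp_homothety_le μ hK hKm hgm hy (t := 1 - t)
                (by linarith) (by linarith [ht.1])
              simpa [add_comm] using this
          _ = _ := by simp
      · exact (hgm.comp (by fun_prop : Continuous fun q : E × E =>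
          (1 - t) • q.1 + t • q.2).measurable).aemeasurable
  calc ∫⁻ x in K, ∫⁻ y in K, ENNReal.ofReal ((h x - h y) ^ 2) ∂μ ∂μ
      ≤ ∫⁻ x in K, ∫⁻ y in K, ENNReal.ofReal (D ^ 2) *
          ∫⁻ t in Ioc (0 : ℝ) 1, g ((1 - t) • x + t • y) ∂volume ∂μ ∂μ := by
        refine setLIntegral_mono' hKm fun x hx => setLIntegral_mono' hKm fun y hy => ?_
        refine (ofReal_sq_sub_le_lintegral_segment hh x y).trans ?_
        gcongr
        exact hD x hx y hy
    _ = ENNReal.ofReal (D ^ 2) * ∫⁻ x in K, ∫⁻ y in K,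
          ∫⁻ t in Ioc (0 : ℝ) 1, g ((1 - t) • x + t • y) ∂volume ∂μ ∂μ := by
        simp_rw [lintegral_const_mul' _ _ ENNReal.ofReal_ne_top]
    _ = ENNReal.ofReal (D ^ 2) * ∫⁻ t in Ioc (0 : ℝ) 1, ∫⁻ x in K, ∫⁻ y in K,
          g ((1 - t) • x + t • y) ∂μ ∂μ ∂volume := by
        congr 1
        have e1 : ∀ x, ∫⁻ y in K, ∫⁻ t in Ioc (0 : ℝ) 1, g ((1 - t) • x + t • y) ∂volume ∂μ =
            ∫⁻ t in Ioc (0 : ℝ) 1, ∫⁻ y in K, g ((1 - t) • x + t • y) ∂μ ∂volume := fun x =>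
          lintegral_lintegral_swap (hgm.comp (by fun_prop : Continuous fun q : E × ℝ =>
            (1 - q.2) • x + q.2 • q.1).measurable).aemeasurable
        simp_rw [e1]
        refine lintegral_lintegral_swap (Measurable.aemeasurable ?_)
        refine Measurable.lintegral_prod_right' (f := fun (q : (E × ℝ) × E) =>
          g ((1 - q.1.2) • q.1.1 + q.1.2 • q.2)) ?_
        exact hgm.comp (by fun_prop : Continuous fun q : (E × ℝ) × E =>
          (1 - q.1.2) • q.1.1 + q.1.2 • q.2).measurable
    _ ≤ ENNReal.ofReal (D ^ 2) * ∫⁻ t in Ioc (0 : ℝ) 1, 2 ^ finrank ℝ E * I * μ K := by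
        gcongr 1
        exact setLIntegral_mono' measurableSet_Ioc key
    _ = _ := by simp [mul_assoc]

/-- **Poincaré inequality on a ball**: some constant `c` satisfies
`∫ (h - c)² ≤ (2R)² 2^dim ∫ ‖dh‖²`. -/
lemma exists_setIntegral_closedBall_sq_sub_le {R : ℝ} (hR : 0 < R) {h : E → ℝ}
    (hh : ContDiff ℝ 1 h) :
    ∃ c : ℝ, ∫ y in Metric.closedBall (0 : E) R, (h y - c) ^ 2 ∂μ ≤
      (2 * R) ^ 2 * 2 ^ finrank ℝ E * ∫ y in Metric.closedBall (0 : E) R, ‖fderiv ℝ h y‖ ^ 2 ∂μ := by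
  set K := Metric.closedBall (0 : E) R with hKdef
  have hKc : IsCompact K := isCompact_closedBall 0 R
  have hc : Continuous (fderiv ℝ h) := hh.continuous_fderiv one_ne_zero
  have hhc : Continuous h := hh.continuous
  have hK0 : μ K ≠ 0 := (Metric.measure_closedBall_pos μ 0 hR).ne'
  have hKt : μ K ≠ ⊤ := hKc.measure_lt_top.ne
  have hm := lintegral_lintegral_sq_sub_le μ (convex_closedBall (0 : E) R)
    Metric.isClosed_closedBall.measurableSet (D := 2 * R) (fun x hx y hy => by
      rw [mem_closedBall_zero_iff] at hx hy
      linarith [norm_sub_le x y]) hh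
  rw [← hKdef] at hm
  have hmeas : AEMeasurable (fun x => ∫⁻ y in K, ENNReal.ofReal ((h x - h y) ^ 2) ∂μ)
      (μ.restrict K) := by
    refine (Measurable.lintegral_prod_right' (f := fun q : E × E =>
      ENNReal.ofReal ((h q.1 - h q.2) ^ 2)) ?_).aemeasurable
    exact ENNReal.measurable_ofReal.comp
      (by fun_prop : Continuous fun q : E × E => (h q.1 - h q.2) ^ 2).measurable
  -- Some `x₀` makes the inner integral at most its average over `K`; `h x₀` then serves as the
  -- constant in place of the mean of `h`.
  obtain ⟨x₀, -, hx₀⟩ := exists_le_setLAverage hK0 hKt hmeas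
  rw [setLAverage_eq] at hx₀
  refine ⟨h x₀, ?_⟩
  have h1 := hx₀.trans (ENNReal.div_le_of_le_mul hm)
  have i1 : IntegrableOn (fun y => (h y - h x₀) ^ 2) K μ :=
    (by fun_prop : Continuous _).continuousOn.integrableOn_compact hKc
  have i2 : IntegrableOn (fun y => ‖fderiv ℝ h y‖ ^ 2) K μ :=
    (by fun_prop : Continuous _).continuousOn.integrableOn_compact hKc
  simp_rw [sub_sq_comm (h x₀)] at h1
  rw [← ofReal_integral_eq_lintegral_ofReal i1 (.of_forall fun y => by positivity),
    ← ofReal_integral_eq_lintegral_ofReal i2 (.of_forall fun y => by positivity)] at h1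
  have h2 : (2 : ℝ≥0∞) ^ finrank ℝ E = ENNReal.ofReal (2 ^ finrank ℝ E) := by
    rw [ENNReal.ofReal_pow zero_le_two]; norm_num
  rw [h2, ← ENNReal.ofReal_mul (by positivity), ← ENNReal.ofReal_mul (by positivity)] at h1
  exact (ENNReal.ofReal_le_ofReal_iff
    (mul_nonneg (by positivity) (integral_nonneg fun y => by positivity))).1 h1

end LocalPoincare

/-! ### Gaussian integrability and the divergence theorem for radial fields. -/

section GaussianTail

open MeasureTheory Module

variable {E : Type*} [NormedAddCommGroup E] [InnerProductSpace ℝ E] [FiniteDimensional ℝ E]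
  [MeasurableSpace E] [BorelSpace E]

lemma integrable_exp_neg_mul_sq_norm {b : ℝ} (hb : 0 < b) :
    Integrable (fun x : E => Real.exp (-b * ‖x‖ ^ 2)) := by
  have h := (GaussianFourier.integrable_cexp_neg_mul_sq_norm_add (V := E) (b := b)
    (by simpa using hb) 0 0).norm
  refine h.congr (.of_forall fun x => ?_)
  simp only [Complex.norm_exp]
  congr 1
  simp [← Complex.ofReal_pow]

/-- A continuous weight with Gaussian decay has finite second moments. -/
lemma integrable_one_add_norm_sq_mul {w : E → ℝ} (hw : Continuous w) {b A : ℝ} (hb : 0 < b)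
    (hwb : ∀ x, |w x| ≤ A * Real.exp (-b * ‖x‖ ^ 2)) :
    Integrable (fun x => (1 + ‖x‖) ^ 2 * w x) := by
  have hA : 0 ≤ A := by
    have := (abs_nonneg _).trans (hwb 0)
    simpa using this
  refine ((integrable_exp_neg_mul_sq_norm (E := E) (half_pos hb)).const_mul
    ((2 + 4 / b) * A)).mono' (by fun_prop : Continuous _).aestronglyMeasurable
    (.of_forall fun x => ?_)
  rw [Real.norm_eq_abs, abs_mul, abs_of_nonneg (by positivity : (0 : ℝ) ≤ (1 + ‖x‖) ^ 2)]
  -- Half of the Gaussian exponent absorbs the polynomial. The factor `2 + 4 / b` comes from `(1 +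
  -- r)² ≤ 2 + 2r²` and `exp t ≥ 1 + t`.
  have h1 : (1 + ‖x‖) ^ 2 ≤ (2 + 4 / b) * Real.exp (b / 2 * ‖x‖ ^ 2) := by
    have h2 := Real.add_one_le_exp (b / 2 * ‖x‖ ^ 2)
    have h3 : (2 + 4 / b) * (b / 2 * ‖x‖ ^ 2 + 1) = 2 * ‖x‖ ^ 2 + 2 + (b * ‖x‖ ^ 2 + 4 / b) := by
      field_simp; ring
    have h4 : 0 ≤ b * ‖x‖ ^ 2 + 4 / b := by positivity
    have h5 := mul_le_mul_of_nonneg_left h2 (by positivity : 0 ≤ 2 + 4 / b)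
    nlinarith [sq_nonneg (1 - ‖x‖)]
  calc (1 + ‖x‖) ^ 2 * |w x|
      ≤ ((2 + 4 / b) * Real.exp (b / 2 * ‖x‖ ^ 2)) * (A * Real.exp (-b * ‖x‖ ^ 2)) := by
        gcongr
        exact hwb x
    _ = (2 + 4 / b) * A * (Real.exp (b / 2 * ‖x‖ ^ 2) * Real.exp (-b * ‖x‖ ^ 2)) := by ring
    _ = _ := by rw [← Real.exp_add]; congr 2; ring

/-- The divergence theorem on the whole space for the radial field `φ(x) x`. -/
lemma integral_fderiv_apply_self {φ : E → ℝ} (hφ : Differentiable ℝ φ)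
    (h0 : Integrable fun x => (1 + ‖x‖) * ‖φ x‖)
    (h1 : Integrable fun x => (1 + ‖x‖) * ‖fderiv ℝ φ x‖) :
    ∫ x, fderiv ℝ φ x x = -(finrank ℝ E * ∫ x, φ x) := by
  set b := stdOrthonormalBasis ℝ E
  have i0 : Integrable φ := h0.mono' hφ.continuous.aestronglyMeasurable
    (.of_forall fun x => by nlinarith [norm_nonneg x, norm_nonneg (φ x)])
  have hb : ∀ i x, |inner ℝ (b i) x| ≤ 1 + ‖x‖ := fun i x => by
    have := abs_real_inner_le_norm (b i) x
    rw [b.norm_eq_one] at this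
    linarith
  have i1 : ∀ i, Integrable fun x => fderiv ℝ φ x (b i) * inner ℝ (b i) x := fun i => by
    refine h1.mono' ((measurable_fderiv_apply_const ℝ φ (b i)).mul
      (by fun_prop : Continuous fun x => inner ℝ (b i) x).measurable).aestronglyMeasurable
      (.of_forall fun x => ?_)
    rw [norm_mul, mul_comm, Real.norm_eq_abs]
    gcongr
    · exact hb i x
    · simpa [b.norm_eq_one] using (fderiv ℝ φ x).le_opNorm (b i)
  have i2 : ∀ i, Integrable fun x => φ x * inner ℝ (b i) x := fun i => by
    refine h0.mono' (hφ.continuous.mul (by fun_prop)).aestronglyMeasurable (.of_forall fun x => ?_)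
    rw [norm_mul, mul_comm, Real.norm_eq_abs (inner ℝ (b i) x)]
    gcongr
    exact hb i x
  -- Integration by parts in direction `b i` against the coordinate `⟨b i, x⟩`, whose derivative is
  -- `1`; the sum over `i` produces the dimension.
  have ibp : ∀ i, ∫ x, fderiv ℝ φ x (b i) * inner ℝ (b i) x = -∫ x, φ x := fun i => by
    have hg : ∀ x, fderiv ℝ (fun x => inner ℝ (b i) x) x (b i) = (1 : ℝ) := fun x => by
      have : HasFDerivAt (fun x => inner ℝ (b i) x) (innerSL ℝ (b i)) x :=
        (innerSL ℝ (b i)).hasFDerivAt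
      rw [this.fderiv]
      simp [b.norm_eq_one]
    have := integral_mul_fderiv_eq_neg_fderiv_mul_of_integrable (μ := (volume : Measure E))
      (f := φ) (g := fun x => inner ℝ (b i) x) (v := b i) (i1 i) (by simpa [hg] using i0) (i2 i)
      (fun x _ => hφ x) (fun x _ => (innerSL ℝ (b i)).differentiableAt)
    simp only [hg, mul_one] at this
    linarith
  have hsum : ∀ x, fderiv ℝ φ x x = ∑ i, fderiv ℝ φ x (b i) * inner ℝ (b i) x := fun x => by
    conv_lhs => rw [← b.sum_repr x]
    simp only [map_sum, map_smul, smul_eq_mul, b.repr_apply_apply]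
    conv_lhs => rw [b.sum_repr' x]
    simp [mul_comm]
  simp_rw [hsum]
  rw [integral_finsetSum _ fun i _ => i1 i]
  simp [ibp]

end GaussianTail

/-! ### Poincaré inequality for Gibbs measures of dissipative potentials. -/

section GibbsPoincareInequality

open MeasureTheory Module

lemma exp_neg_div_le {E : Type*} [NormedAddCommGroup E] {f : E → ℝ} {c C s : ℝ}
    (hlow : ∀ x, c * ‖x‖ ^ 2 - C ≤ f x) (hs : 0 < s) (x : E) :
    |Real.exp (-(2 * f x) / s)| ≤ Real.exp (2 * C / s) * Real.exp (-(2 * c / s) * ‖x‖ ^ 2) := by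
  rw [abs_of_pos (Real.exp_pos _), ← Real.exp_add, Real.exp_le_exp]
  have : 2 * C / s + -(2 * c / s) * ‖x‖ ^ 2 = -(2 * (c * ‖x‖ ^ 2 - C)) / s := by ring
  rw [this]
  gcongr
  exact hlow x

variable {E : Type*} [NormedAddCommGroup E] [InnerProductSpace ℝ E] [FiniteDimensional ℝ E]
  [MeasurableSpace E] [BorelSpace E]

lemma integrable_one_add_norm_sq_mul_exp {f : E → ℝ} (hf : Continuous f) {c C s : ℝ}
    (hc : 0 < c) (hlow : ∀ x, c * ‖x‖ ^ 2 - C ≤ f x) (hs : 0 < s) :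
    Integrable (fun x => (1 + ‖x‖) ^ 2 * Real.exp (-(2 * f x) / s)) :=
  integrable_one_add_norm_sq_mul (by fun_prop) (b := 2 * c / s) (by positivity)
    (exp_neg_div_le hlow hs)

lemma integrable_exp_of_quadratic_lower_bound {f : E → ℝ} (hf : Continuous f) {c C s : ℝ}
    (hc : 0 < c) (hlow : ∀ x, c * ‖x‖ ^ 2 - C ≤ f x) (hs : 0 < s) :
    Integrable (fun x => Real.exp (-(2 * f x) / s)) := by
  refine (integrable_one_add_norm_sq_mul_exp hf hc hlow hs).mono'
    (by fun_prop : Continuous _).aestronglyMeasurable (.of_forall fun x => ?_)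
  rw [Real.norm_eq_abs, abs_of_pos (Real.exp_pos _)]
  nlinarith [norm_nonneg x, Real.exp_pos (-(2 * f x) / s),
    mul_nonneg (norm_nonneg x) (Real.exp_pos (-(2 * f x) / s)).le,
    mul_nonneg (sq_nonneg ‖x‖) (Real.exp_pos (-(2 * f x) / s)).le]

/-- **Lyapunov estimate.** For a dissipative potential, the weighted `L²` norm of `u` is controlled
by that of its derivative and by the contribution of a ball. -/
lemma integral_sq_mul_exp_le {f : E → ℝ} (hf : Differentiable ℝ f) {c C G D s R : ℝ}
    (hc : 0 < c) (hlow : ∀ x, c * ‖x‖ ^ 2 - C ≤ f x)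
    (hgrow : ∀ x, ‖fderiv ℝ f x‖ ≤ G * (1 + ‖x‖))
    (hdiss : ∀ x, c * ‖x‖ ^ 2 - D ≤ fderiv ℝ f x x) (hD : 0 ≤ D) (hs : 0 < s)
    (hR : 2 * D / s + finrank ℝ E + 1 ≤ c / s * R ^ 2) (hR0 : 0 ≤ R)
    {u : E → ℝ} (hu : ContDiff ℝ 1 u) {M M' : ℝ} (hM : ∀ x, |u x| ≤ M)
    (hM' : ∀ x, ‖fderiv ℝ u x‖ ≤ M') :
    ∫ x, u x ^ 2 * Real.exp (-(2 * f x) / s) ≤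
      s / c * (∫ x, ‖fderiv ℝ u x‖ ^ 2 * Real.exp (-(2 * f x) / s)) +
      (2 * D / s + finrank ℝ E + 1) *
        ∫ x in Metric.closedBall (0 : E) R, u x ^ 2 * Real.exp (-(2 * f x) / s) := by
  set w : E → ℝ := fun x => Real.exp (-(2 * f x) / s) with hw
  set K := 2 * D / s + finrank ℝ E with hK
  have hfc : Continuous f := hf.continuous
  have hwc : Continuous w := by fun_prop
  have hw0 : ∀ x, 0 < w x := fun x => Real.exp_pos _
  have iW := integrable_one_add_norm_sq_mul_exp hfc hc hlow hs
  have iw := integrable_exp_of_quadratic_lower_bound hfc hc hlow hs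
  have huc : Continuous u := hu.continuous
  have hduc : Continuous (fderiv ℝ u) := hu.continuous_fderiv one_ne_zero
  have hM0 : 0 ≤ M := (abs_nonneg _).trans (hM 0)
  have hM'0 : 0 ≤ M' := (norm_nonneg _).trans (hM' 0)
  have hG0 : 0 ≤ G := by simpa using (norm_nonneg _).trans (hgrow 0)
  have husq : ∀ x, u x ^ 2 ≤ M ^ 2 := fun x => sq_le_sq' (abs_le.1 (hM x)).1 (abs_le.1 (hM x)).2
  set φ : E → ℝ := fun x => u x ^ 2 * w x with hφ
  have hφd : ∀ x, HasFDerivAt φ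
      ((u x ^ 2) • (w x • (-(2 / s)) • fderiv ℝ f x) + w x • ((2 * u x) • fderiv ℝ u x)) x := by
    intro x
    have h1 : HasFDerivAt (fun x => -(2 * f x) / s) ((-(2 / s)) • fderiv ℝ f x) x := by
      convert! (hf x).hasFDerivAt.const_mul (-(2 / s)) using 2
      ring
    have h2 : HasFDerivAt (fun x => u x ^ 2) ((2 * u x) • fderiv ℝ u x) x := by
      convert! ((hu.differentiable one_ne_zero x).hasFDerivAt).pow 2 using 1
      ext v; simp
    exact h2.mul h1.exp
  have iφ : Integrable φ := by
    refine (iw.const_mul (M ^ 2)).mono' (by fun_prop : Continuous _).aestronglyMeasurable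
      (.of_forall fun x => ?_)
    rw [Real.norm_eq_abs, abs_of_nonneg (mul_nonneg (sq_nonneg _) (hw0 x).le)]
    exact mul_le_mul_of_nonneg_right (husq x) (hw0 x).le
  have idu : Integrable fun x => ‖fderiv ℝ u x‖ ^ 2 * w x := by
    refine (iw.const_mul (M' ^ 2)).mono' (by fun_prop : Continuous _).aestronglyMeasurable
      (.of_forall fun x => ?_)
    rw [Real.norm_eq_abs, abs_of_nonneg (mul_nonneg (sq_nonneg _) (hw0 x).le)]
    have := hM' x
    have := (hw0 x).le
    gcongr
  have hφdiff : Differentiable ℝ φ := fun x => (hφd x).differentiableAt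
  have h0 : Integrable fun x => (1 + ‖x‖) * ‖φ x‖ := by
    refine (iW.const_mul (M ^ 2)).mono' (by fun_prop : Continuous _).aestronglyMeasurable
      (.of_forall fun x => ?_)
    rw [Real.norm_eq_abs, abs_of_nonneg (by positivity), Real.norm_eq_abs,
      abs_of_nonneg (mul_nonneg (sq_nonneg _) (hw0 x).le)]
    have h1 := mul_le_mul_of_nonneg_right (husq x) (hw0 x).le
    have h2 : 0 ≤ M ^ 2 * w x := mul_nonneg (sq_nonneg _) (hw0 x).le
    have h3 := norm_nonneg x
    calc (1 + ‖x‖) * (u x ^ 2 * w x) ≤ (1 + ‖x‖) ^ 2 * (M ^ 2 * w x) := by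
          gcongr
          nlinarith
      _ = _ := by ring
  have h1 : Integrable fun x => (1 + ‖x‖) * ‖fderiv ℝ φ x‖ := by
    refine (iW.const_mul (M ^ 2 * (2 / s) * G + 2 * M * M')).mono'
      ((by fun_prop : Continuous fun x : E => 1 + ‖x‖).measurable.mul
        (measurable_fderiv ℝ φ).norm).aestronglyMeasurable (.of_forall fun x => ?_)
    rw [Real.norm_eq_abs, abs_of_nonneg (by positivity), (hφd x).fderiv]
    have h3 := norm_nonneg x
    have h4 := (hw0 x).le
    have h5 : ‖(u x ^ 2) • (w x • (-(2 / s)) • fderiv ℝ f x) +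
        w x • ((2 * u x) • fderiv ℝ u x)‖ ≤
        M ^ 2 * (w x * ((2 / s) * (G * (1 + ‖x‖)))) + w x * (2 * M * M') := by
      refine (norm_add_le _ _).trans ?_
      simp only [norm_smul, norm_neg, Real.norm_eq_abs, abs_of_pos (hw0 x), abs_mul, abs_two,
        abs_of_nonneg (sq_nonneg (u x)), abs_of_pos (div_pos two_pos hs)]
      have := husq x; have := hM x; have := hM' x; have := hgrow x
      gcongr
    calc _ ≤ (1 + ‖x‖) * (M ^ 2 * (w x * ((2 / s) * (G * (1 + ‖x‖)))) +
            w x * (2 * M * M') * (1 + ‖x‖)) := by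
          refine mul_le_mul_of_nonneg_left (h5.trans ?_) (by positivity)
          refine add_le_add_right ?_ _
          refine le_mul_of_one_le_right (by positivity) (by linarith)
      _ = _ := by ring
  have hint := integral_fderiv_apply_self hφdiff h0 h1
  have idφ : Integrable fun x => fderiv ℝ φ x x := by
    have hmeas : Measurable fun x => fderiv ℝ φ x x :=
      (by fun_prop : Continuous fun q : (E →L[ℝ] ℝ) × E => q.1 q.2).measurable.comp
        ((measurable_fderiv ℝ φ).prodMk measurable_id)
    refine h1.mono' hmeas.aestronglyMeasurable (.of_forall fun x => ?_)
    nlinarith [(fderiv ℝ φ x).le_opNorm x, norm_nonneg (fderiv ℝ φ x)]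
  set B := Metric.closedBall (0 : E) R with hB
  have hBm : MeasurableSet B := Metric.isClosed_closedBall.measurableSet
  -- The subtracted bracket is the divergence of `φ(x) x`, whose integral vanishes by `hint`.
  have pw : ∀ x, φ x ≤ s / c * (‖fderiv ℝ u x‖ ^ 2 * w x) + (K + 1) * B.indicator φ x -
      (fderiv ℝ φ x x + finrank ℝ E * φ x) := by
    intro x
    have hφ0 : 0 ≤ φ x := mul_nonneg (sq_nonneg _) (hw0 x).le
    have hK0 : 0 ≤ K := by positivity
    -- Outside the ball the choice of `R` makes `c / s * ‖x‖ ^ 2` exceed `K + 1`; inside, the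
    -- indicator term pays.
    have a1 : φ x * (K + 1) ≤ c / s * ‖x‖ ^ 2 * φ x + (K + 1) * B.indicator φ x := by
      by_cases hx : x ∈ B
      · rw [Set.indicator_of_mem hx]
        have : 0 ≤ c / s * ‖x‖ ^ 2 * φ x := by positivity
        linarith
      · rw [Set.indicator_of_notMem hx]
        have hx' : R < ‖x‖ := by simpa [hB] using hx
        have : c / s * R ^ 2 ≤ c / s * ‖x‖ ^ 2 := by gcongr
        nlinarith
    have a2 : fderiv ℝ φ x x = 2 * (u x * fderiv ℝ u x x) * w x -
        2 / s * fderiv ℝ f x x * φ x := by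
      rw [(hφd x).fderiv, hφ]
      simp
      ring
    have a3 : (2 * c / s * ‖x‖ ^ 2 - 2 * D / s) * φ x ≤ 2 / s * fderiv ℝ f x x * φ x := by
      refine mul_le_mul_of_nonneg_right ?_ hφ0
      have := mul_le_mul_of_nonneg_left (hdiss x) (div_pos two_pos hs).le
      calc _ = 2 / s * (c * ‖x‖ ^ 2 - D) := by ring
        _ ≤ _ := this
    -- Young's inequality, weighted to consume exactly half of the `2c/s ‖x‖²` supplied by
    -- dissipativity in `a3`; `a1` uses the other half.
    have a4 : 2 * (u x * fderiv ℝ u x x) ≤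
        c / s * ‖x‖ ^ 2 * u x ^ 2 + s / c * ‖fderiv ℝ u x‖ ^ 2 := by
      have b1 : u x * fderiv ℝ u x x ≤ (|u x| * ‖x‖) * ‖fderiv ℝ u x‖ := by
        calc _ ≤ |u x * fderiv ℝ u x x| := le_abs_self _
          _ = |u x| * ‖fderiv ℝ u x x‖ := abs_mul _ _
          _ ≤ |u x| * (‖fderiv ℝ u x‖ * ‖x‖) := by
              gcongr; exact (fderiv ℝ u x).le_opNorm x
          _ = _ := by ring
      have b2 : c / s * ‖x‖ ^ 2 * u x ^ 2 + s / c * ‖fderiv ℝ u x‖ ^ 2 -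
          2 * ((|u x| * ‖x‖) * ‖fderiv ℝ u x‖) =
          (c * (|u x| * ‖x‖) - s * ‖fderiv ℝ u x‖) ^ 2 / (s * c) := by
        rw [← sq_abs (u x)]
        field_simp
        ring
      have b3 : 0 ≤ (c * (|u x| * ‖x‖) - s * ‖fderiv ℝ u x‖) ^ 2 / (s * c) := by positivity
      linarith
    have a5 := mul_le_mul_of_nonneg_right a4 (hw0 x).le
    have a6 : (c / s * ‖x‖ ^ 2 * u x ^ 2 + s / c * ‖fderiv ℝ u x‖ ^ 2) * w x =
        c / s * ‖x‖ ^ 2 * φ x + s / c * (‖fderiv ℝ u x‖ ^ 2 * w x) := by rw [hφ]; ring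
    have a7 : φ x * (K + 1) = 2 * D / s * φ x + finrank ℝ E * φ x + φ x := by rw [hK]; ring
    have a8 : (2 * c / s * ‖x‖ ^ 2 - 2 * D / s) * φ x =
      2 * (c / s * ‖x‖ ^ 2 * φ x) - 2 * D / s * φ x := by ring
    linarith
  have iB : Integrable (B.indicator φ) := iφ.indicator hBm
  calc ∫ x, φ x ≤ ∫ x, (s / c * (‖fderiv ℝ u x‖ ^ 2 * w x) + (K + 1) * B.indicator φ x -
        (fderiv ℝ φ x x + finrank ℝ E * φ x)) :=
        integral_mono iφ (((idu.const_mul _).add (iB.const_mul _)).sub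
          (idφ.add (iφ.const_mul _))) pw
    _ = _ := by
        rw [integral_sub
            (f := fun x => s / c * (‖fderiv ℝ u x‖ ^ 2 * w x) + (K + 1) * B.indicator φ x)
            (g := fun x => fderiv ℝ φ x x + finrank ℝ E * φ x)
            ((idu.const_mul _).add (iB.const_mul _)) (idφ.add (iφ.const_mul _)),
          integral_add (idu.const_mul _) (iB.const_mul _),
          integral_add idφ (iφ.const_mul _), integral_const_mul, integral_const_mul,
          integral_const_mul, hint, integral_indicator hBm]
        ring

/-- The Lyapunov estimate combined with the Poincaré inequality on a large ball. -/
lemma exists_weighted_poincare {f : E → ℝ} (hf : Differentiable ℝ f) {c C G D s : ℝ}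
    (hc : 0 < c) (hlow : ∀ x, c * ‖x‖ ^ 2 - C ≤ f x)
    (hgrow : ∀ x, ‖fderiv ℝ f x‖ ≤ G * (1 + ‖x‖))
    (hdiss : ∀ x, c * ‖x‖ ^ 2 - D ≤ fderiv ℝ f x x) (hs : 0 < s) :
    ∃ A : ℝ, 0 < A ∧ ∀ h : E → ℝ, ContDiff ℝ 1 h → HasCompactSupport h → ∃ k : ℝ,
      ∫ x, (h x - k) ^ 2 * Real.exp (-(2 * f x) / s) ≤
        A * ∫ x, ‖fderiv ℝ h x‖ ^ 2 * Real.exp (-(2 * f x) / s) := by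
  set w : E → ℝ := fun x => Real.exp (-(2 * f x) / s) with hw
  have hfc : Continuous f := hf.continuous
  have hwc : Continuous w := by fun_prop
  have hw0 : ∀ x, 0 < w x := fun x => Real.exp_pos _
  have iw := integrable_exp_of_quadratic_lower_bound hfc hc hlow hs
  have hD : 0 ≤ D := by simpa using hdiss 0
  set K1 := 2 * D / s + finrank ℝ E + 1 with hK1
  have hK1p : 0 < K1 := by positivity
  obtain ⟨R, hR0, hR⟩ : ∃ R : ℝ, 0 < R ∧ K1 ≤ c / s * R ^ 2 := by
    refine ⟨K1 * s / c + 1, by positivity, ?_⟩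
    have h1 : c / s * (K1 * s / c) = K1 := by field_simp
    have h2 : 0 ≤ K1 * s / c := by positivity
    calc K1 = c / s * (K1 * s / c) := h1.symm
      _ ≤ _ := by
        gcongr
        nlinarith
  set B := Metric.closedBall (0 : E) R with hB
  have hBc : IsCompact B := isCompact_closedBall 0 R
  have hBm : MeasurableSet B := Metric.isClosed_closedBall.measurableSet
  obtain ⟨xm, -, hxm⟩ := hBc.exists_isMinOn ⟨0, by simp [hB, hR0.le]⟩ hwc.continuousOn
  obtain ⟨xM, -, hxM⟩ := hBc.exists_isMaxOn ⟨0, by simp [hB, hR0.le]⟩ hwc.continuousOn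
  rw [isMinOn_iff] at hxm
  rw [isMaxOn_iff] at hxM
  set P := (2 * R) ^ 2 * 2 ^ finrank ℝ E with hP
  refine ⟨s / c + K1 * (w xM * P / w xm), by
    have := hw0 xM; have := hw0 xm; positivity, fun h hh hsupp => ?_⟩
  have hhc : Continuous h := hh.continuous
  have hdc : Continuous (fderiv ℝ h) := hh.continuous_fderiv one_ne_zero
  obtain ⟨k, hk⟩ := exists_setIntegral_closedBall_sq_sub_le (volume : Measure E) hR0 hh
  obtain ⟨M, hM⟩ := hsupp.exists_bound_of_continuous hhc
  obtain ⟨M', hM'⟩ := (hsupp.fderiv ℝ).exists_bound_of_continuous hdc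
  refine ⟨k, ?_⟩
  have hdk : ∀ x, fderiv ℝ (fun x => h x - k) x = fderiv ℝ h x := fun x => fderiv_sub_const _
  -- `h - k` need not have compact support, but it and its derivative are bounded, which is all the
  -- Lyapunov estimate asks.
  have main := integral_sq_mul_exp_le hf hc hlow hgrow hdiss hD hs hR hR0.le
    (u := fun x => h x - k) (hh.sub contDiff_const) (M := M + |k|) (M' := M')
    (fun x => (abs_sub _ _).trans (by simpa using hM x)) (fun x => by rw [hdk]; exact hM' x)
  simp only [hdk] at main
  have idu : Integrable fun x => ‖fderiv ℝ h x‖ ^ 2 * w x := by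
    refine (iw.const_mul (M' ^ 2)).mono' (by fun_prop : Continuous _).aestronglyMeasurable
      (.of_forall fun x => ?_)
    rw [Real.norm_eq_abs, abs_of_nonneg (mul_nonneg (sq_nonneg _) (hw0 x).le)]
    have := hM' x
    have := (hw0 x).le
    gcongr
  have iB : ∀ g : E → ℝ, Continuous g → IntegrableOn g B := fun g hg =>
    hg.continuousOn.integrableOn_compact hBc
  have e1 : ∫ x in B, (h x - k) ^ 2 * w x ≤ w xM * ∫ x in B, (h x - k) ^ 2 := by
    rw [← integral_const_mul]
    refine setIntegral_mono_on (iB _ (by fun_prop)) (iB _ (by fun_prop)) hBm fun x hx => ?_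
    rw [mul_comm]
    exact mul_le_mul_of_nonneg_right (hxM x hx) (sq_nonneg _)
  have e2 : w xm * ∫ x in B, ‖fderiv ℝ h x‖ ^ 2 ≤ ∫ x in B, ‖fderiv ℝ h x‖ ^ 2 * w x := by
    rw [← integral_const_mul]
    refine setIntegral_mono_on (iB _ (by fun_prop)) (iB _ (by fun_prop)) hBm fun x hx => ?_
    rw [mul_comm]
    exact mul_le_mul_of_nonneg_left (hxm x hx) (sq_nonneg _)
  have e3 : ∫ x in B, ‖fderiv ℝ h x‖ ^ 2 * w x ≤ ∫ x, ‖fderiv ℝ h x‖ ^ 2 * w x :=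
    setIntegral_le_integral idu (.of_forall fun x => mul_nonneg (sq_nonneg _) (hw0 x).le)
  have e4 : ∫ x in B, ‖fderiv ℝ h x‖ ^ 2 ≤ (∫ x, ‖fderiv ℝ h x‖ ^ 2 * w x) / w xm := by
    rw [le_div_iff₀ (hw0 xm)]
    linarith
  have hwM := (hw0 xM).le
  have hP0 : 0 ≤ P := by positivity
  calc ∫ x, (h x - k) ^ 2 * w x
      ≤ s / c * (∫ x, ‖fderiv ℝ h x‖ ^ 2 * w x) + K1 * ∫ x in B, (h x - k) ^ 2 * w x := main
    _ ≤ s / c * (∫ x, ‖fderiv ℝ h x‖ ^ 2 * w x) +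
          K1 * (w xM * (P * ((∫ x, ‖fderiv ℝ h x‖ ^ 2 * w x) / w xm))) := by
        gcongr
        exact e1.trans (mul_le_mul_of_nonneg_left
          (hk.trans (mul_le_mul_of_nonneg_left e4 hP0)) hwM)
    _ = _ := by ring

/-- **Poincaré inequality for Gibbs measures** of differentiable dissipative potentials with
quadratic growth. -/
theorem exists_gibbsPoincare {f : E → ℝ} (hf : Differentiable ℝ f) {c C G D s : ℝ}
    (hc : 0 < c) (hlow : ∀ x, c * ‖x‖ ^ 2 - C ≤ f x)
    (hgrow : ∀ x, ‖fderiv ℝ f x‖ ≤ G * (1 + ‖x‖))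
    (hdiss : ∀ x, c * ‖x‖ ^ 2 - D ≤ fderiv ℝ f x x) (hs : 0 < s) :
    ∃ lams : ℝ, GibbsPoincare f s lams := by
  obtain ⟨A, hA, hP⟩ := exists_weighted_poincare hf hc hlow hgrow hdiss hs
  have iw := integrable_exp_of_quadratic_lower_bound hf.continuous hc hlow hs
  refine ⟨s / (2 * A), iw, by positivity, fun h hh hsupp => ?_⟩
  obtain ⟨k, hk⟩ := hP h (hh.of_le (by exact_mod_cast le_top)) hsupp
  have : IsProbabilityMeasure (gibbsMeasure f s) := isProbabilityMeasure_tilted iw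
  have hg : ∀ x, ‖gradient h x‖ = ‖fderiv ℝ h x‖ := fun x => by simp [gradient]
  have hs' : s / (2 * (s / (2 * A))) = A := by field_simp
  have hm : AEStronglyMeasurable h (gibbsMeasure f s) := hh.continuous.aestronglyMeasurable
  -- The variance is at most the second moment about any constant, so `k` need not be the Gibbs
  -- mean; the normalization `Z_s` cancels from both sides.
  rw [hs', ← ProbabilityTheory.variance_sub_const hm k]
  refine (ProbabilityTheory.variance_le_expectation_sq
    (hm.sub aestronglyMeasurable_const)).trans ?_
  simp only [hg, gibbsMeasure, integral_tilted, Pi.pow_apply, smul_eq_mul, div_mul_eq_mul_div,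
    integral_div]
  rw [← mul_div_assoc]
  refine div_le_div_of_nonneg_right ?_ (integral_nonneg fun x => (Real.exp_pos _).le)
  simpa only [mul_comm, Pi.sub_apply] using hk

end GibbsPoincareInequality

/-! ### A criterion for Villani functions. -/

section VillaniCriterion

open Module Filter Bornology

variable {E : Type*} [NormedAddCommGroup E] [InnerProductSpace ℝ E] [FiniteDimensional ℝ E]

lemma norm_gradient_eq_norm_fderiv (f : E → ℝ) (x : E) : ‖gradient f x‖ = ‖fderiv ℝ f x‖ := by
  simp [gradient]

/-- The Laplacian is the trace of the Hessian, and the operator norm of the Hessian at `x` is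
bounded by a Lipschitz constant of the derivative based at `x` alone. -/
lemma abs_laplacian_le {f : E → ℝ} {x : E} {K : ℝ} (hK0 : 0 ≤ K)
    (hK : ∀ y, ‖fderiv ℝ f y - fderiv ℝ f x‖ ≤ K * ‖y - x‖) :
    |Laplacian.laplacian f x| ≤ finrank ℝ E * K := by
  have hn : ‖fderiv ℝ (fderiv ℝ f) x‖ ≤ K := norm_fderiv_le_of_lip' ℝ hK0 (.of_forall hK)
  rw [InnerProductSpace.laplacian_eq_iteratedFDeriv_stdOrthonormalBasis]
  simp only [iteratedFDeriv_two_apply]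
  refine (Finset.abs_sum_le_sum_abs _ _).trans ?_
  calc _ ≤ ∑ _i : Fin (finrank ℝ E), K := by
        refine Finset.sum_le_sum fun i _ => ?_
        have := (fderiv ℝ (fderiv ℝ f) x).le_opNorm₂
          (stdOrthonormalBasis ℝ E i) (stdOrthonormalBasis ℝ E i)
        simp only [(stdOrthonormalBasis ℝ E).norm_eq_one, mul_one, Real.norm_eq_abs] at this
        exact this.trans hn
    _ = _ := by simp

/-- Smooth functions with quadratic lower bound, dissipative gradient and a gradient that is
Lipschitz up to linear growth are Villani functions. -/
theorem isVillani_of_dissipative [MeasurableSpace E] [BorelSpace E] {f : E → ℝ}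
    (hf : ContDiff ℝ ∞ f) {c C D H : ℝ}
    (hc : 0 < c) (hlow : ∀ x, c * ‖x‖ ^ 2 - C ≤ f x)
    (hdiss : ∀ x, c * ‖x‖ ^ 2 - D ≤ fderiv ℝ f x x) (hH : 0 ≤ H)
    (hlip : ∀ x y, ‖fderiv ℝ f y - fderiv ℝ f x‖ ≤ H * (1 + ‖x‖) * ‖y - x‖) :
    IsVillani f where
  smooth := hf
  tendsto_top := by
    refine tendsto_atTop_mono hlow (tendsto_atTop_add_const_right _ _ ?_)
    exact (((tendsto_pow_atTop two_ne_zero).comp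
      tendsto_norm_cobounded_atTop).const_mul_atTop hc)
  integrable_exp s hs := integrable_exp_of_quadratic_lower_bound hf.continuous hc hlow hs
  tendsto_laplacian s hs := by
    set N : ℝ := finrank ℝ E * H with hN
    have hN0 : 0 ≤ N := by positivity
    have hlap : ∀ x, Laplacian.laplacian f x ≤ N * (1 + ‖x‖) := fun x =>
      (le_abs_self _).trans ((abs_laplacian_le (by positivity) (hlip x)).trans_eq
        (mul_assoc _ _ _).symm)
    -- The minorant combines `‖∇f‖ ≥ (c/2)‖x‖` for large `‖x‖` with `N(1 + ‖x‖) ≤ 2N‖x‖` for `‖x‖ ≥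
    -- 1`.
    have hT : Tendsto (fun x : E => ‖x‖ * (c ^ 2 / (4 * s) * ‖x‖ - 2 * N)) (cobounded E) atTop :=
      tendsto_norm_cobounded_atTop.atTop_mul_atTop₀ (tendsto_atTop_add_const_right _ _
        (tendsto_norm_cobounded_atTop.const_mul_atTop (by positivity)))
    refine tendsto_atTop_mono' _ ?_ hT
    filter_upwards [tendsto_norm_cobounded_atTop.eventually_ge_atTop 1,
      tendsto_norm_cobounded_atTop.eventually_ge_atTop (2 * |D| / c)] with x h1 h2
    rw [norm_gradient_eq_norm_fderiv]
    have h3 := (le_abs_self _).trans ((fderiv ℝ f x).le_opNorm x)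
    have h4 := hdiss x
    have h5 : 2 * |D| ≤ ‖x‖ * c := (div_le_iff₀ hc).1 h2
    have h6 : c / 2 * ‖x‖ ≤ ‖fderiv ℝ f x‖ := by
      refine le_of_mul_le_mul_right ?_ (by linarith : 0 < ‖x‖)
      have := le_mul_of_one_le_right (by positivity : 0 ≤ c / 2 * ‖x‖) h1
      linarith [le_abs_self D, show c * ‖x‖ ^ 2 = 2 * (c / 2 * ‖x‖ * ‖x‖) by ring]
    have h7 : (c / 2 * ‖x‖) ^ 2 ≤ ‖fderiv ℝ f x‖ ^ 2 := by gcongr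
    have h8 := mul_le_mul_of_nonneg_left h7 (one_div_pos.2 hs).le
    have h9 : 1 / s * (c / 2 * ‖x‖) ^ 2 = c ^ 2 / (4 * s) * ‖x‖ ^ 2 := by ring
    nlinarith [hlap x]

end VillaniCriterion

/-! ### Gradient and Lipschitz estimates for the net and a single data loss. -/

section DepthTwoNet

variable {p d : ℕ}

/-- The rank-one matrix `b xᵀ` as an element of the weight space. -/
def outerWeight (b : Fin p → ℝ) (x : EuclideanSpace ℝ (Fin d)) : WeightSpace p d :=
  WithLp.toLp 2 fun jk => b jk.1 * x jk.2

lemma norm_outerWeight_sq (b : Fin p → ℝ) (x : EuclideanSpace ℝ (Fin d)) :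
    ‖outerWeight b x‖ ^ 2 = (∑ j, b j ^ 2) * ‖x‖ ^ 2 := by
  simp only [EuclideanSpace.norm_sq_eq, outerWeight, Real.norm_eq_abs, sq_abs, mul_pow,
    Fintype.sum_prod_type, Finset.sum_mul_sum]

lemma outerWeight_sub (b b' : Fin p → ℝ) (x : EuclideanSpace ℝ (Fin d)) :
    outerWeight b x - outerWeight b' x = outerWeight (fun j => b j - b' j) x := by
  ext jk
  simp [outerWeight, sub_mul]

lemma sum_sq_row_le (W : WeightSpace p d) (x : EuclideanSpace ℝ (Fin d)) :
    ∑ j, (∑ k, W (j, k) * x k) ^ 2 ≤ ‖W‖ ^ 2 * ‖x‖ ^ 2 := by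
  simp only [EuclideanSpace.norm_sq_eq, Real.norm_eq_abs, sq_abs, Fintype.sum_prod_type]
  rw [Finset.sum_mul]
  exact Finset.sum_le_sum fun j _ => Finset.sum_mul_sq_le_sq_mul_sq _ _ _

lemma sum_sq_mul_le (a : EuclideanSpace ℝ (Fin p)) {b : Fin p → ℝ} {M : ℝ}
    (hb : ∀ j, |b j| ≤ M) : ∑ j, (a j * b j) ^ 2 ≤ ‖a‖ ^ 2 * M ^ 2 := by
  simp only [EuclideanSpace.norm_sq_eq, Real.norm_eq_abs, sq_abs, Finset.sum_mul, mul_pow]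
  exact Finset.sum_le_sum fun j _ => mul_le_mul_of_nonneg_left
    (sq_le_sq' (abs_le.1 (hb j)).1 (abs_le.1 (hb j)).2) (sq_nonneg _)

lemma abs_row_sub_le (W V : WeightSpace p d) (x : EuclideanSpace ℝ (Fin d)) (j : Fin p) :
    |(∑ k, W (j, k) * x k) - ∑ k, V (j, k) * x k| ≤ ‖W - V‖ * ‖x‖ := by
  refine abs_le_of_sq_le_sq ?_ (by positivity)
  rw [mul_pow]
  refine le_trans ?_ (sum_sq_row_le (W - V) x)
  have : (∑ k, W (j, k) * x k) - ∑ k, V (j, k) * x k = ∑ k, (W - V) (j, k) * x k := by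
    simp [sub_mul, Finset.sum_sub_distrib]
  rw [this]
  exact Finset.single_le_sum (f := fun j => (∑ k, (W - V) (j, k) * x k) ^ 2)
    (fun j _ => sq_nonneg _) (Finset.mem_univ j)

variable {σ : ℝ → ℝ} (a : EuclideanSpace ℝ (Fin p)) (x : EuclideanSpace ℝ (Fin d))

/-- The gradient of `W ↦ aᵀ σ(W x)`. -/
noncomputable def netGradient (σ : ℝ → ℝ) (W : WeightSpace p d) : WeightSpace p d :=
  outerWeight (fun j => a j * deriv σ (∑ k, W (j, k) * x k)) x

lemma hasGradientAt_depthTwoNet (hσ : Differentiable ℝ σ) (W : WeightSpace p d) :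
    HasGradientAt (fun W => depthTwoNet σ a W x) (netGradient a x σ W) W := by
  rw [hasGradientAt_iff_hasFDerivAt]
  have hrow : ∀ j, HasFDerivAt (fun W : WeightSpace p d => ∑ k, W (j, k) * x k)
      (∑ k, x k • (EuclideanSpace.proj (j, k) : WeightSpace p d →L[ℝ] ℝ)) W := fun j =>
    HasFDerivAt.fun_sum fun k _ =>
      (EuclideanSpace.proj (j, k) : WeightSpace p d →L[ℝ] ℝ).hasFDerivAt.mul_const (x k)
  have h := HasFDerivAt.fun_sum (u := Finset.univ) fun j _ =>
    ((hσ _).hasDerivAt.comp_hasFDerivAt W (hrow j)).const_mul (a j)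
  convert! h using 1
  ext V
  simp [netGradient, outerWeight, PiLp.inner_apply, Fintype.sum_prod_type, Finset.mul_sum,
    mul_assoc, mul_comm, mul_left_comm]

lemma norm_netGradient_le {MD : ℝ} (hMD : ∀ t, |deriv σ t| ≤ MD) (W : WeightSpace p d) :
    ‖netGradient a x σ W‖ ≤ ‖a‖ * MD * ‖x‖ := by
  have hMD0 := (abs_nonneg _).trans (hMD 0)
  refine le_of_sq_le_sq ?_ (by positivity)
  rw [netGradient, norm_outerWeight_sq, mul_pow, mul_pow]
  gcongr
  exact sum_sq_mul_le a fun j => hMD _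

lemma norm_netGradient_sub_le {K : ℝ} (hK : ∀ t u, |deriv σ t - deriv σ u| ≤ K * |t - u|)
    (hK0 : 0 ≤ K) (W V : WeightSpace p d) :
    ‖netGradient a x σ W - netGradient a x σ V‖ ≤ ‖a‖ * K * ‖x‖ ^ 2 * ‖W - V‖ := by
  refine le_of_sq_le_sq ?_ (by positivity)
  rw [netGradient, netGradient, outerWeight_sub, norm_outerWeight_sq]
  simp only [← mul_sub]
  have := sum_sq_mul_le a (b := fun j => deriv σ (∑ k, W (j, k) * x k) -
    deriv σ (∑ k, V (j, k) * x k)) (M := K * (‖W - V‖ * ‖x‖)) fun j =>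
      (hK _ _).trans (mul_le_mul_of_nonneg_left (abs_row_sub_le W V x j) hK0)
  calc _ ≤ ‖a‖ ^ 2 * (K * (‖W - V‖ * ‖x‖)) ^ 2 * ‖x‖ ^ 2 := by gcongr
    _ = _ := by ring

lemma abs_depthTwoNet_sub_le {K : ℝ} (hK : ∀ t u, |σ t - σ u| ≤ K * |t - u|) (hK0 : 0 ≤ K)
    (W V : WeightSpace p d) :
    |depthTwoNet σ a W x - depthTwoNet σ a V x| ≤ ‖a‖ * K * ‖x‖ * ‖W - V‖ := by
  refine abs_le_of_sq_le_sq ?_ (by positivity)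
  rw [depthTwoNet, depthTwoNet, ← Finset.sum_sub_distrib]
  simp only [← mul_sub]
  refine (Finset.sum_mul_sq_le_sq_mul_sq _ _ _).trans ?_
  have h1 : ∑ j, (σ (∑ k, W (j, k) * x k) - σ (∑ k, V (j, k) * x k)) ^ 2 ≤
      K ^ 2 * (‖W - V‖ ^ 2 * ‖x‖ ^ 2) := by
    refine le_trans ?_ (mul_le_mul_of_nonneg_left (sum_sq_row_le (W - V) x) (sq_nonneg K))
    rw [Finset.mul_sum]
    refine Finset.sum_le_sum fun j _ => ?_
    have h2 := hK (∑ k, W (j, k) * x k) (∑ k, V (j, k) * x k)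
    have h3 : (∑ k, W (j, k) * x k) - ∑ k, V (j, k) * x k = ∑ k, (W - V) (j, k) * x k := by
      simp [sub_mul, Finset.sum_sub_distrib]
    rw [h3] at h2
    rw [← sq_abs, ← sq_abs (∑ k, (W - V) (j, k) * x k), ← mul_pow]
    gcongr
  have h4 : ∑ j, a j ^ 2 = ‖a‖ ^ 2 := by simp [EuclideanSpace.norm_sq_eq]
  rw [h4]
  calc _ ≤ ‖a‖ ^ 2 * (K ^ 2 * (‖W - V‖ ^ 2 * ‖x‖ ^ 2)) := by gcongr
    _ = _ := by ring

/-- Cauchy–Schwarz against `σ(Wx)`, a vector of `p` entries bounded by `B`; this is the source of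
`√p`. -/
lemma abs_depthTwoNet_le {B : ℝ} (hB : ∀ t, |σ t| ≤ B) (W : WeightSpace p d) :
    |depthTwoNet σ a W x| ≤ Real.sqrt p * ‖a‖ * B := by
  have hB0 := (abs_nonneg _).trans (hB 0)
  refine abs_le_of_sq_le_sq ?_ (by positivity)
  rw [depthTwoNet]
  refine (Finset.sum_mul_sq_le_sq_mul_sq _ _ _).trans ?_
  have h4 : ∑ j, a j ^ 2 = ‖a‖ ^ 2 := by simp [EuclideanSpace.norm_sq_eq]
  have h1 : ∑ j : Fin p, σ (∑ k, W (j, k) * x k) ^ 2 ≤ p * B ^ 2 := by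
    calc _ ≤ ∑ _j : Fin p, B ^ 2 :=
          Finset.sum_le_sum fun j _ => sq_le_sq' (abs_le.1 (hB _)).1 (abs_le.1 (hB _)).2
      _ = _ := by simp
  rw [h4, mul_pow, mul_pow, Real.sq_sqrt (Nat.cast_nonneg p)]
  calc _ ≤ ‖a‖ ^ 2 * (p * B ^ 2) := by gcongr
    _ = _ := by ring

lemma hasGradientAt_dataLoss (hσ : Differentiable ℝ σ) (y : ℝ) (W : WeightSpace p d) :
    HasGradientAt (dataLoss σ a x y) ((depthTwoNet σ a W x - y) • netGradient a x σ W) W := by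
  have h := ((((hasGradientAt_depthTwoNet a x hσ W).hasFDerivAt).const_sub y).pow 2).const_mul
    (1 / 2)
  rw [hasGradientAt_iff_hasFDerivAt]
  convert! h using 1
  ext V
  simp
  ring

/-- The product difference is split so that the residual appears only at `V`. The constant then
depends on one endpoint, so an unbounded residual still gives the one-sided growth `H(1 + ‖V‖)` used
for the Villani condition. -/
lemma norm_dataLoss_gradient_sub_le {MD K : ℝ}
    (hL : ∀ t u, |σ t - σ u| ≤ MD * |t - u|) (hMD : ∀ t, |deriv σ t| ≤ MD)
    (hK : ∀ t u, |deriv σ t - deriv σ u| ≤ K * |t - u|) (hK0 : 0 ≤ K) (y : ℝ)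
    (W V : WeightSpace p d) :
    ‖(depthTwoNet σ a W x - y) • netGradient a x σ W -
        (depthTwoNet σ a V x - y) • netGradient a x σ V‖ ≤
      (‖a‖ ^ 2 * MD ^ 2 * ‖x‖ ^ 2 + |depthTwoNet σ a V x - y| * (‖a‖ * K * ‖x‖ ^ 2)) *
        ‖W - V‖ := by
  have hMD0 := (abs_nonneg _).trans (hMD 0)
  have e : (depthTwoNet σ a W x - y) • netGradient a x σ W -
        (depthTwoNet σ a V x - y) • netGradient a x σ V =
      (depthTwoNet σ a W x - depthTwoNet σ a V x) • netGradient a x σ W +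
        (depthTwoNet σ a V x - y) • (netGradient a x σ W - netGradient a x σ V) := by module
  rw [e]
  refine (norm_add_le _ _).trans ?_
  rw [norm_smul, norm_smul, Real.norm_eq_abs, Real.norm_eq_abs]
  have h1 := abs_depthTwoNet_sub_le a x hL hMD0 W V
  have h2 := norm_netGradient_le a x hMD W
  have h3 := norm_netGradient_sub_le a x hK hK0 W V
  calc _ ≤ (‖a‖ * MD * ‖x‖ * ‖W - V‖) * (‖a‖ * MD * ‖x‖) +
        |depthTwoNet σ a V x - y| * (‖a‖ * K * ‖x‖ ^ 2 * ‖W - V‖) := by gcongr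
    _ = _ := by ring

lemma contDiff_depthTwoNet (hσ : ContDiff ℝ ∞ σ) :
    ContDiff ℝ ∞ fun W : WeightSpace p d => depthTwoNet σ a W x := by
  unfold depthTwoNet
  fun_prop

end DepthTwoNet

/-! ### Dissipativity and smoothness of the regularized loss. -/

section RegularizedLoss

variable {n p d : ℕ} {σ : ℝ → ℝ} (a : EuclideanSpace ℝ (Fin p))
  (x : Fin n → EuclideanSpace ℝ (Fin d)) (y : Fin n → ℝ)

lemma contDiff_regLoss (hσ : ContDiff ℝ ∞ σ) (lam : ℝ) :
    ContDiff ℝ ∞ (regLoss σ a x y lam) := by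
  have h := fun i => contDiff_depthTwoNet (σ := σ) a (x i) hσ
  have h2 : ContDiff ℝ ∞ fun W : WeightSpace p d => ‖W‖ ^ 2 := contDiff_norm_sq ℝ
  unfold regLoss dataLoss
  fun_prop

lemma quadratic_le_regLoss (lam : ℝ) (W : WeightSpace p d) :
    lam / 2 * ‖W‖ ^ 2 ≤ regLoss σ a x y lam W := by
  unfold regLoss dataLoss
  have : 0 ≤ (1 / (n : ℝ)) * ∑ i, 1 / 2 * (y i - depthTwoNet σ a W (x i)) ^ 2 := by positivity
  linarith

/-- The gradient of the unregularized empirical risk. -/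
noncomputable def riskGradient (σ : ℝ → ℝ) (W : WeightSpace p d) : WeightSpace p d :=
  (1 / (n : ℝ)) • ∑ i, (depthTwoNet σ a W (x i) - y i) • netGradient a (x i) σ W

lemma hasGradientAt_regLoss (hσ : Differentiable ℝ σ) (lam : ℝ) (W : WeightSpace p d) :
    HasGradientAt (regLoss σ a x y lam) (riskGradient a x y σ W + lam • W) W := by
  have h1 := (HasFDerivAt.fun_sum (u := Finset.univ) fun i _ =>
    (hasGradientAt_dataLoss a (x i) hσ (y i) W).hasFDerivAt).const_mul (1 / (n : ℝ))
  have h2 := ((hasStrictFDerivAt_norm_sq W).hasFDerivAt).const_mul (lam / 2)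
  rw [hasGradientAt_iff_hasFDerivAt]
  convert! h1.add h2 using 1
  ext V
  simp [riskGradient]
  ring

lemma norm_average_le {F : Type*} [NormedAddCommGroup F] [NormedSpace ℝ F] (hn : 0 < n)
    {v : Fin n → F} {M : ℝ} (hv : ∀ i, ‖v i‖ ≤ M) : ‖(1 / (n : ℝ)) • ∑ i, v i‖ ≤ M := by
  rw [norm_smul, Real.norm_of_nonneg (by positivity), one_div, inv_mul_le_iff₀ (by positivity)]
  exact (norm_sum_le_of_le _ fun i _ => hv i).trans_eq (by simp)

lemma norm_riskGradient_le (hn : 0 < n) {MD Bx r : ℝ} (hBx : ∀ i, ‖x i‖ ≤ Bx)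
    (hMD : ∀ t, |deriv σ t| ≤ MD) {W : WeightSpace p d}
    (hr : ∀ i, |depthTwoNet σ a W (x i) - y i| ≤ r) :
    ‖riskGradient a x y σ W‖ ≤ r * (‖a‖ * MD * Bx) := by
  have hMD0 := (abs_nonneg _).trans (hMD 0)
  refine norm_average_le hn fun i => ?_
  rw [norm_smul, Real.norm_eq_abs]
  have h1 := norm_netGradient_le a (x i) hMD W
  have h2 := hBx i
  have hr0 := (abs_nonneg _).trans (hr i)
  have := hr i
  calc _ ≤ r * (‖a‖ * MD * ‖x i‖) := by gcongr
    _ ≤ _ := by gcongr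

lemma norm_riskGradient_sub_le (hn : 0 < n) {MD Bx K r : ℝ} (hBx : ∀ i, ‖x i‖ ≤ Bx)
    (hL : ∀ t u, |σ t - σ u| ≤ MD * |t - u|) (hMD : ∀ t, |deriv σ t| ≤ MD)
    (hK : ∀ t u, |deriv σ t - deriv σ u| ≤ K * |t - u|) (hK0 : 0 ≤ K) {V : WeightSpace p d}
    (hr : ∀ i, |depthTwoNet σ a V (x i) - y i| ≤ r) (W : WeightSpace p d) :
    ‖riskGradient a x y σ W - riskGradient a x y σ V‖ ≤
      (‖a‖ ^ 2 * MD ^ 2 * Bx ^ 2 + r * (‖a‖ * K * Bx ^ 2)) * ‖W - V‖ := by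
  rw [riskGradient, riskGradient, ← smul_sub, ← Finset.sum_sub_distrib]
  refine norm_average_le hn fun i => ?_
  refine (norm_dataLoss_gradient_sub_le a (x i) hL hMD hK hK0 (y i) W V).trans ?_
  have h2 := hBx i
  have hr0 := (abs_nonneg _).trans (hr i)
  have := hr i
  gcongr

lemma norm_regGradient_sub_le (hn : 0 < n) {MD Bx K r lam : ℝ} (hlam : 0 ≤ lam)
    (hBx : ∀ i, ‖x i‖ ≤ Bx)
    (hL : ∀ t u, |σ t - σ u| ≤ MD * |t - u|) (hMD : ∀ t, |deriv σ t| ≤ MD)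
    (hK : ∀ t u, |deriv σ t - deriv σ u| ≤ K * |t - u|) (hK0 : 0 ≤ K) {V : WeightSpace p d}
    (hr : ∀ i, |depthTwoNet σ a V (x i) - y i| ≤ r) (W : WeightSpace p d) :
    ‖(riskGradient a x y σ W + lam • W) - (riskGradient a x y σ V + lam • V)‖ ≤
      (‖a‖ ^ 2 * MD ^ 2 * Bx ^ 2 + r * (‖a‖ * K * Bx ^ 2) + lam) * ‖W - V‖ := by
  have e : (riskGradient a x y σ W + lam • W) - (riskGradient a x y σ V + lam • V) =
      (riskGradient a x y σ W - riskGradient a x y σ V) + lam • (W - V) := by module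
  rw [e, add_mul _ lam]
  refine (norm_add_le _ _).trans (add_le_add
    (norm_riskGradient_sub_le a x y hn hBx hL hMD hK hK0 hr W) ?_)
  rw [norm_smul, Real.norm_of_nonneg hlam]

lemma lipschitz_of_abs_deriv_le {g : ℝ → ℝ} (hg : Differentiable ℝ g) {M : ℝ}
    (hM : ∀ t, |deriv g t| ≤ M) (t u : ℝ) : |g t - g u| ≤ M * |t - u| :=
  Convex.norm_image_sub_le_of_norm_deriv_le (fun z _ => hg z) (fun z _ => hM z) convex_univ
    (Set.mem_univ u) (Set.mem_univ t)

lemma exists_residual_bound {L Bx : ℝ} (hL0 : 0 ≤ L) (hBx : ∀ i, ‖x i‖ ≤ Bx)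
    (hL : ∀ t u, |σ t - σ u| ≤ L * |t - u|) :
    ∃ F : ℝ, 0 ≤ F ∧ ∀ (W : WeightSpace p d) i,
      |depthTwoNet σ a W (x i) - y i| ≤ F + ‖a‖ * L * Bx * ‖W‖ := by
  -- The sum of the residuals at `W = 0` bounds each of them, uniformly in `i`.
  refine ⟨∑ i, |depthTwoNet σ a 0 (x i) - y i|,
    Finset.sum_nonneg fun i _ => abs_nonneg _, fun W i => ?_⟩
  have h1 := abs_depthTwoNet_sub_le a (x i) hL hL0 W 0
  rw [sub_zero] at h1
  have h2 : ‖a‖ * L * ‖x i‖ * ‖W‖ ≤ ‖a‖ * L * Bx * ‖W‖ := by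
    have := hBx i
    gcongr
  have h3 := Finset.single_le_sum (f := fun i => |depthTwoNet σ a 0 (x i) - y i|)
    (fun i _ => abs_nonneg _) (Finset.mem_univ i)
  have h4 := abs_sub_le (depthTwoNet σ a W (x i)) (depthTwoNet σ a 0 (x i)) (y i)
  linarith

/-- Above the critical regularization the loss is dissipative, with a gradient of linear growth. -/
lemma exists_dissipative_regLoss (hn : 0 < n) {Bx MD L lam : ℝ} (hBx : ∀ i, ‖x i‖ ≤ Bx)
    (hσ : Differentiable ℝ σ) (hMD : ∀ t, |deriv σ t| ≤ MD) (hL0 : 0 ≤ L)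
    (hL : ∀ t u, |σ t - σ u| ≤ L * |t - u|) (hlam : 0 < lam)
    (hcrit : criticalReg MD L Bx a < lam) :
    ∃ G D : ℝ,
      (∀ W, ‖fderiv ℝ (regLoss σ a x y lam) W‖ ≤ G * (1 + ‖W‖)) ∧
      (∀ W, lam / 4 * ‖W‖ ^ 2 - D ≤ fderiv ℝ (regLoss σ a x y lam) W W) := by
  obtain ⟨F, hF0, hF⟩ := exists_residual_bound a x y hL0 hBx hL
  have hMD0 := (abs_nonneg _).trans (hMD 0)
  have hBx0 : 0 ≤ Bx := (norm_nonneg _).trans (hBx ⟨0, hn⟩)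
  set F' := F * (‖a‖ * MD * Bx) with hF'
  have hF'0 : 0 ≤ F' := by positivity
  set κ := MD * L * Bx ^ 2 * ‖a‖ ^ 2 with hκ
  have hκ0 : 0 ≤ κ := by positivity
  have hκlam : 2 * κ < lam := by
    rw [criticalReg] at hcrit
    linarith
  have hrisk : ∀ W : WeightSpace p d, ‖riskGradient a x y σ W‖ ≤ F' + κ * ‖W‖ := fun W =>
    (norm_riskGradient_le a x y hn hBx hMD (hF W)).trans_eq (by rw [hF', hκ]; ring)
  -- Since `κ ≤ lam/2`, the pairing with `W` is at least `(lam/2)‖W‖² - F'‖W‖`; completing the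
  -- square leaves `(lam/4)‖W‖² - F'²/lam`.
  refine ⟨F' + κ + lam, F' ^ 2 / lam, fun W => ?_, fun W => ?_⟩
  · rw [← norm_gradient_eq_norm_fderiv, (hasGradientAt_regLoss a x y hσ lam W).gradient]
    refine (norm_add_le _ _).trans ?_
    rw [norm_smul, Real.norm_of_nonneg hlam.le]
    nlinarith [hrisk W, norm_nonneg W, mul_nonneg hF'0 (norm_nonneg W)]
  · rw [(hasGradientAt_regLoss a x y hσ lam W).fderiv_apply, inner_add_left,
      real_inner_smul_left, real_inner_self_eq_norm_sq]
    have h1 := (abs_le.1 (abs_real_inner_le_norm (riskGradient a x y σ W) W)).1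
    have h2 := mul_le_mul_of_nonneg_right (hrisk W) (norm_nonneg W)
    have h3 : lam / 4 * ‖W‖ ^ 2 - F' * ‖W‖ + F' ^ 2 / lam = (lam / 2 * ‖W‖ - F') ^ 2 / lam := by
      field_simp
      ring
    have h4 : 0 ≤ (lam / 2 * ‖W‖ - F') ^ 2 / lam := by positivity
    nlinarith [mul_nonneg (sub_nonneg.2 hκlam.le) (sq_nonneg ‖W‖)]

lemma isVillani_regLoss (hn : 0 < n) {Bx MD L MD2 lam : ℝ} (hBx : ∀ i, ‖x i‖ ≤ Bx)
    (hσ : ContDiff ℝ ∞ σ) (hMD : ∀ t, |deriv σ t| ≤ MD) (hL0 : 0 ≤ L)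
    (hL : ∀ t u, |σ t - σ u| ≤ L * |t - u|) (hMD2 : ∀ t, |deriv (deriv σ) t| ≤ MD2)
    (hlam : 0 < lam) (hcrit : criticalReg MD L Bx a < lam) :
    IsVillani (regLoss σ a x y lam) := by
  have hσd : Differentiable ℝ σ := hσ.differentiable (by simp)
  have hσd2 : Differentiable ℝ (deriv σ) :=
    (contDiff_infty_iff_deriv.1 hσ).2.differentiable (by simp)
  obtain ⟨G, D, -, hdiss⟩ := exists_dissipative_regLoss a x y hn hBx hσd hMD hL0 hL hlam hcrit
  obtain ⟨F, hF0, hF⟩ := exists_residual_bound a x y hL0 hBx hL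
  have hMD0 := (abs_nonneg _).trans (hMD 0)
  have hMD20 := (abs_nonneg _).trans (hMD2 0)
  have hBx0 : 0 ≤ Bx := (norm_nonneg _).trans (hBx ⟨0, hn⟩)
  set P := ‖a‖ ^ 2 * MD ^ 2 * Bx ^ 2 with hP
  set Q := ‖a‖ * MD2 * Bx ^ 2 with hQ
  have hP0 : 0 ≤ P := by positivity
  have hQ0 : 0 ≤ Q := by positivity
  -- `H` is the sum of the two coefficients of a Lipschitz constant affine in `‖V‖`: `α + βt ≤ (α +
  -- β)(1 + t)`.
  refine isVillani_of_dissipative (contDiff_regLoss a x y hσ lam) (c := lam / 4) (C := 0) (D := D)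
    (H := P + F * Q + lam + ‖a‖ * L * Bx * Q) (by positivity)
    (fun W => ?_) hdiss (by positivity) (fun V W => ?_)
  · have := quadratic_le_regLoss (σ := σ) a x y lam W
    nlinarith [mul_nonneg hlam.le (sq_nonneg ‖W‖)]
  · have hgrad := fun W => (hasGradientAt_regLoss a x y hσd lam W).hasFDerivAt.fderiv
    rw [hgrad, hgrad, ← map_sub, LinearIsometryEquiv.norm_map]
    refine (norm_regGradient_sub_le a x y hn hlam.le hBx (lipschitz_of_abs_deriv_le hσd hMD) hMD
      (lipschitz_of_abs_deriv_le hσd2 hMD2) hMD20 (hF V) W).trans ?_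
    refine mul_le_mul_of_nonneg_right ?_ (norm_nonneg _)
    have hV := norm_nonneg V
    have h1 : 0 ≤ (P + F * Q + lam) * ‖V‖ := by positivity
    have h2 : 0 ≤ ‖a‖ * L * Bx * Q := by positivity
    calc P + (F + ‖a‖ * L * Bx * ‖V‖) * Q + lam
        ≤ P + (F + ‖a‖ * L * Bx * ‖V‖) * Q + lam + (P + F * Q + lam) * ‖V‖ +
          ‖a‖ * L * Bx * Q := by linarith
      _ = _ := by ring

lemma gibbsPoincare_regLoss (hn : 0 < n) {Bx MD L lam s : ℝ} (hBx : ∀ i, ‖x i‖ ≤ Bx)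
    (hσ : Differentiable ℝ σ) (hMD : ∀ t, |deriv σ t| ≤ MD) (hL0 : 0 ≤ L)
    (hL : ∀ t u, |σ t - σ u| ≤ L * |t - u|)
    (hlam : 0 < lam) (hcrit : criticalReg MD L Bx a < lam) (hs : 0 < s) :
    ∃ lams : ℝ, GibbsPoincare (regLoss σ a x y lam) s lams := by
  obtain ⟨G, D, hgrow, hdiss⟩ := exists_dissipative_regLoss a x y hn hBx hσ hMD hL0 hL hlam hcrit
  refine exists_gibbsPoincare (fun W => (hasGradientAt_regLoss a x y hσ lam W).differentiableAt)
    (c := lam / 4) (C := 0) (by positivity) (fun W => ?_) hgrow hdiss hs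
  have := quadratic_le_regLoss (σ := σ) a x y lam W
  nlinarith [mul_nonneg hlam.le (sq_nonneg ‖W‖)]

/-- For a bounded activation with bounded, Lipschitz derivative the loss is smooth in the sense of
optimization, with an explicit constant. -/
lemma isGradLipschitz_regLoss (hn : 0 < n) {Bx By MD K B lam : ℝ} (hlam : 0 ≤ lam)
    (hBx : ∀ i, ‖x i‖ ≤ Bx) (hBy : ∀ i, |y i| ≤ By) (hσ : Differentiable ℝ σ)
    (hMD : ∀ t, |deriv σ t| ≤ MD) (hB : ∀ t, |σ t| ≤ B)
    (hK : ∀ t u, |deriv σ t - deriv σ u| ≤ K * |t - u|) (hK0 : 0 ≤ K) :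
    IsGradLipschitz (regLoss σ a x y lam) (‖a‖ ^ 2 * MD ^ 2 * Bx ^ 2 +
      (Real.sqrt p * ‖a‖ * B + By) * (‖a‖ * K * Bx ^ 2) + lam) := by
  refine ⟨fun W => (hasGradientAt_regLoss a x y hσ lam W).differentiableAt, fun W V => ?_⟩
  rw [(hasGradientAt_regLoss a x y hσ lam W).gradient,
    (hasGradientAt_regLoss a x y hσ lam V).gradient]
  exact norm_regGradient_sub_le a x y hn hlam hBx (lipschitz_of_abs_deriv_le hσ hMD) hMD hK hK0
    (fun i => (abs_sub _ _).trans (add_le_add (abs_depthTwoNet_le a (x i) hB V) (hBy i))) W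

end RegularizedLoss

/-! ### Assembly and comparison of constants. -/

theorem lemma3p1 {n p d : ℕ} (hn : 0 < n) (hp : 0 < p)
    (σ : ℝ → ℝ) (a : EuclideanSpace ℝ (Fin p))
    (x : Fin n → EuclideanSpace ℝ (Fin d)) (y : Fin n → ℝ)
    (Bx By MD L lam : ℝ)
    (hBx : ∀ i, ‖x i‖ ≤ Bx) (hBy : ∀ i, |y i| ≤ By)
    (hσ : Differentiable ℝ σ) (hMD : ∀ t, |deriv σ t| ≤ MD)
    (hL : ∀ t u, |σ t - σ u| ≤ L * |t - u|)
    (hlam : 0 < lam) :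
    -- above the threshold: Villani condition and Poincaré-type inequality
    (criticalReg MD L Bx a < lam →
      (∀ MD' : ℝ, ContDiff ℝ ∞ σ → (∀ t, |deriv (deriv σ) t| ≤ MD') →
        IsVillani (regLoss σ a x y lam)) ∧
      (∀ s : ℝ, 0 < s → ∃ lams : ℝ, GibbsPoincare (regLoss σ a x y lam) s lams)) ∧
    -- gradient-Lipschitz bound for bounded smooth activations
    (∀ Bσ Lσ' MD' : ℝ, ContDiff ℝ ∞ σ → (∀ t, |σ t| ≤ Bσ) →
      (∀ t u, |deriv σ t - deriv σ u| ≤ Lσ' * |t - u|) →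
      (∀ t, |deriv (deriv σ) t| ≤ MD') →
      ∃ gLip : ℝ, 0 < gLip ∧ IsGradLipschitz (regLoss σ a x y lam) gLip ∧
        gLip ≤ Real.sqrt p *
          (‖a‖ * Bx ^ 2 * By * Lσ' + Real.sqrt p * ‖a‖ ^ 2 * MD ^ 2 * Bx ^ 2
            + p * ‖a‖ ^ 2 * Bx ^ 2 * MD' * Bσ + lam)) := by
  have hL0 : 0 ≤ L := by simpa using (abs_nonneg _).trans (hL 1 0)
  refine ⟨fun hcrit => ⟨fun MD' hσs hMD' =>
    isVillani_regLoss a x y hn hBx hσs hMD hL0 hL hMD' hlam hcrit, fun s hs =>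
    gibbsPoincare_regLoss a x y hn hBx hσ hMD hL0 hL hlam hcrit hs⟩, ?_⟩
  intro Bσ Lσ' MD' hσs hBσ hLσ' hMD'
  have hσd : Differentiable ℝ (deriv σ) :=
    (contDiff_infty_iff_deriv.1 hσs).2.differentiable (by simp)
  have hBσ0 := (abs_nonneg _).trans (hBσ 0)
  have hMD0 := (abs_nonneg _).trans (hMD 0)
  have hMD'0 := (abs_nonneg _).trans (hMD' 0)
  have hBy0 := (abs_nonneg _).trans (hBy ⟨0, hn⟩)
  have hBx0 := (norm_nonneg _).trans (hBx ⟨0, hn⟩)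
  have hLσ'0 : 0 ≤ Lσ' := by simpa using (abs_nonneg _).trans (hLσ' 1 0)
  -- Both `Lσ'` and `MD'` are Lipschitz constants of `σ'`. With their minimum, the `By` term can be
  -- bounded through `Lσ'` and the `Bσ` term through `MD'`; the surplus powers of `p` are slack, as
  -- `p ≥ 1`.
  have hK : ∀ t u, |deriv σ t - deriv σ u| ≤ min Lσ' MD' * |t - u| := fun t u => by
    rw [min_mul_of_nonneg _ _ (abs_nonneg _)]
    exact le_min (hLσ' t u) (lipschitz_of_abs_deriv_le hσd hMD' t u)
  have hK0 : 0 ≤ min Lσ' MD' := le_min hLσ'0 hMD'0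
  refine ⟨_, by positivity, isGradLipschitz_regLoss a x y hn hlam.le hBx hBy hσ hMD hBσ hK hK0, ?_⟩
  have hp1 : (1 : ℝ) ≤ p := by exact_mod_cast hp
  have hq : 1 ≤ Real.sqrt p := Real.one_le_sqrt.2 hp1
  have h1 : By * (‖a‖ * min Lσ' MD' * Bx ^ 2) ≤ ‖a‖ * Bx ^ 2 * By * Lσ' := by
    calc _ ≤ By * (‖a‖ * Lσ' * Bx ^ 2) := by gcongr; exact min_le_left _ _
      _ = _ := by ring
  have h2 : ‖a‖ ^ 2 * MD ^ 2 * Bx ^ 2 ≤ Real.sqrt p * ‖a‖ ^ 2 * MD ^ 2 * Bx ^ 2 := by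
    calc _ = 1 * (‖a‖ ^ 2 * MD ^ 2 * Bx ^ 2) := (one_mul _).symm
      _ ≤ Real.sqrt p * (‖a‖ ^ 2 * MD ^ 2 * Bx ^ 2) := by gcongr
      _ = _ := by ring
  have h3 : Real.sqrt p * ‖a‖ * Bσ * (‖a‖ * min Lσ' MD' * Bx ^ 2) ≤
      Real.sqrt p * (p * ‖a‖ ^ 2 * Bx ^ 2 * MD' * Bσ) := by
    calc _ ≤ Real.sqrt p * ‖a‖ * Bσ * (‖a‖ * MD' * Bx ^ 2) := by gcongr; exact min_le_right _ _
      _ = Real.sqrt p * (1 * (‖a‖ ^ 2 * Bx ^ 2 * MD' * Bσ)) := by ring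
      _ ≤ Real.sqrt p * (p * (‖a‖ ^ 2 * Bx ^ 2 * MD' * Bσ)) := by gcongr
      _ = _ := by ring
  have h4 : ‖a‖ * Bx ^ 2 * By * Lσ' + Real.sqrt p * ‖a‖ ^ 2 * MD ^ 2 * Bx ^ 2 + lam ≤
      Real.sqrt p *
        (‖a‖ * Bx ^ 2 * By * Lσ' + Real.sqrt p * ‖a‖ ^ 2 * MD ^ 2 * Bx ^ 2 + lam) :=
    le_mul_of_one_le_left (by positivity) hq
  linarith
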